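/- Let $d\in\mathbb N$, $N\ge 2$, and let $\mathcal W=\{\mathbb R^d; f_1,\dots,f_N; p_1,\dots,p_N\}$ be a weighted iterated function system: $f_1,\dots,f_N:\mathbb R^d\to\mathbb R^d$ are contractions and $p_i>0$, $\sum_{i=1}^N p_i=1$. Suppose that for all $i$ and all $x,y\in\mathbb R^d$, $$s_i\|x-y\|\le\|f_i(x)-f_i(y)\|\le c_i\|x-y\|,\qquad 0<s_i\le c_i<1 .$$ Let $E$ be the attractor of $\mathcal W$ (the unique non-empty compact set with $E=\bigcup_{i=1}^N f_i(E)$), let $\mu$ be the invariant measure of $\mathcal W$ (the unique Borel probability measure supported on $E$ with $\mu=\sum_{i=1}^N p_i\,\mu\circ f_i^{-1}$), and suppose that $\mathcal W$ satisfies the strong open set condition: there is an open set $O\subset\mathbb R^d$ with $f_i(O)\subset O$ for all $i$, $f_i(O)\cap f_j(O)=\emptyset$ for $i\ne j$, and $O\cap E\ne\emptyset$. Let $r\in(0,\infty)$. For $n\in\mathbb N$ put $$V_{n,r}(\mu)=\inf\Big\{\int \operatorname{dist}(x,A)^r\,d\mu(x): A\subset\mathbb R^d,\ \operatorname{Card}(A)\le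 n\Big\},\qquad e_{n,r}(\mu)=V_{n,r}(\mu)^{1/r},$$ and let $$\underline D_r(\mu)=\liminf_{n\to\infty}\frac{\log n}{-\log e_{n,r}(\mu)},\qquad \overline D_r(\mu)=\limsup_{n\to\infty}\frac{\log n}{-\log e_{n,r}(\mu)}$$ be the lower and upper quantization dimensions of order $r$ of $\mu$. Then there are unique numbers $k_r,l_r\in(0,\infty)$ with $$\sum_{i=1}^N (p_i s_i^r)^{\frac{k_r}{r+k_r}}=1,\qquad \sum_{i=1}^N (p_i c_i^r)^{\frac{l_r}{r+l_r}}=1,$$ and $$k_r\le\underline D_r(\mu)\le\overline D_r(\mu)\le l_r .$$ In particular, if $s_i=c_i$ for all $i$ (so that the $f_i$ are similarities), then $k_r=l_r$ and the limit $D_r(\mu)=\lim_{n\to\infty}\frac{\log n}{-\log e_{n,r}(\mu)}$ exists and equals this number (the Graf–Luschgy formula). -/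

import Mathlib

open MeasureTheory Filter Topology
open scoped ENNReal NNReal

/-- A weighted iterated function system on `Y` with `N` maps: finitely many contractions of `Y`
together with a probability vector all of whose entries are positive. -/
structure WeightedIFS (Y : Type*) [MetricSpace Y] (N : ℕ) where
  /-- the maps of the system -/
  map : Fin N → Y → Y
  /-- each map is a contraction, with its own constant `< 1` -/
  contracting : ∀ i, ∃ K : ℝ≥0, ContractingWith K (map i)
  /-- the weights -/
  weight : Fin N → ℝ
  weight_pos : ∀ i, 0 < weight i
  weight_sum : ∑ i, weight i = 1

namespace WeightedIFS

variable {Y : Type*} [MetricSpace Y] {N : ℕ}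

/-- `E` is the attractor: the nonempty compact set with `E = ⋃ i, f i (E)`
(unique when `Y` is complete). -/
def IsAttractor (W : WeightedIFS Y N) (E : Set Y) : Prop :=
  E.Nonempty ∧ IsCompact E ∧ E = ⋃ i, W.map i '' E

/-- `μ` is the invariant measure of a system with attractor `E`: the Borel probability measure
supported on `E` with `μ = ∑ i, p i • (μ ∘ (f i)⁻¹)`. -/
def IsInvariantMeasure [MeasurableSpace Y] (W : WeightedIFS Y N) (E : Set Y)
    (μ : Measure Y) : Prop :=
  IsProbabilityMeasure μ ∧ μ Eᶜ = 0 ∧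
    μ = ∑ i, ENNReal.ofReal (W.weight i) • μ.map (W.map i)

/-- The strong open set condition for a system with attractor `E`. -/
def StrongOpenSetCondition (W : WeightedIFS Y N) (E : Set Y) : Prop :=
  ∃ O : Set Y, IsOpen O ∧ O.Nonempty ∧
    (∀ i, W.map i '' O ⊆ O) ∧
    (∀ i j, i ≠ j → W.map i '' O ∩ W.map j '' O = ∅) ∧
    (O ∩ E).Nonempty

end WeightedIFS

section Quantization

variable {Y : Type*} [MetricSpace Y] [MeasurableSpace Y]

/-- The `n`-th quantization error `V_{n,r}(μ)`: the infimum of `∫ dist(x, A)^r dμ(x)` over the sets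
`A` with at most `n` points. (For `A = ∅` the distance is `∞`.) -/
noncomputable def quantizationError (μ : Measure Y) (r : ℝ) (n : ℕ) : ℝ≥0∞ :=
  ⨅ (A : Finset Y) (_ : A.card ≤ n), ∫⁻ x, Metric.infEDist x (A : Set Y) ^ r ∂μ

/-- `log n / (- log e_{n,r}(μ))` where `e_{n,r}(μ) = V_{n,r}(μ)^(1/r)`, as an extended real. -/
noncomputable def quantizationRatio (μ : Measure Y) (r : ℝ) (n : ℕ) : EReal :=
  ((Real.log n : ℝ) : EReal) / (-ENNReal.log (quantizationError μ r n ^ (1 / r)))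

/-- The lower quantization dimension of order `r`. -/
noncomputable def lowerQuantizationDim (μ : Measure Y) (r : ℝ) : EReal :=
  liminf (fun n : ℕ => quantizationRatio μ r n) atTop

/-- The upper quantization dimension of order `r`. -/
noncomputable def upperQuantizationDim (μ : Measure Y) (r : ℝ) : EReal :=
  limsup (fun n : ℕ => quantizationRatio μ r n) atTop

end Quantization

/-!
Both bounds come from power laws for the quantization error `V_{n,r}(μ)`; the dimensions are then
read off by taking logarithms.

Upper bound (`exists_finset_lintegral_infEDist_le`). Put `q i = (p i * c i ^ r) ^ (l / (r + l))`, so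
that `∑ i, q i = 1` and `p i * c i ^ r = q i ^ (1 + r / l)`. Invariance of `μ` bounds the error of a
union `⋃ i, f i (A i)` by `∑ i, p i * c i ^ r * error (A i)`. Distributing a real-valued budget `x`
of points as `x * q i` makes the estimate `C * x ^ (-r / l)` reproduce itself exactly, so an
induction on the size of `x` gives `V_{n,r}(μ) ≤ C * n ^ (-r / l)`. No separation is used here.

Lower bound (`le_lintegral_min_infEDist`). Fix `h < k`. By the strong open set condition some word
`u` has `f_u (E) ⊆ O`; then the maps `g v = f_v ∘ f_u`, for `v` ranging over the words of a fixed
length `n`, map `E` to pairwise disjoint compact sets. They form a system with weights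
`P v = p_v * p_u`, of total mass `p_u`, and lower Lipschitz constants `S v = s_v * s_u`. The sum of
`q v = (P v * S v ^ r) ^ (h / (r + h))` over these `v` is
`(∑ i, (p i * s i ^ r) ^ (h / (r + h))) ^ n` times a constant depending only on `u`,
hence at least `1` for large `n`. For this strongly separated system every point of a finite set
`A` is near at most one piece `g v (E)`. An induction as before, now with a bound of the form
`const * (x - card A) * x ^ (-(1 + r / h))`, which is affine in `card A` and therefore adds up over
the pieces, gives `V_{n,r}(μ) ≥ b * n ^ (-r / h)` on setting `x = 2 * n`. Finally `h` tends to `k`.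
-/

/-! ### The dimension equation -/

theorem sum_rpow_strictAnti {ι : Type*} [Fintype ι] [Nonempty ι] {a : ι → ℝ}
    (h0 : ∀ i, 0 < a i) (h1 : ∀ i, a i < 1) : StrictAnti fun θ : ℝ => ∑ i, a i ^ θ :=
  fun _ _ h => Finset.sum_lt_sum_of_nonempty Finset.univ_nonempty fun i _ =>
    Real.rpow_lt_rpow_of_exponent_gt (h0 i) (h1 i) h

theorem div_add_lt_div_add {r h k : ℝ} (hr : 0 < r) (hh : 0 < h) (hk : h < k) :
    h / (r + h) < k / (r + k) := by
  rw [div_lt_div_iff₀ (by linarith) (by linarith)]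
  nlinarith

/-- The substitution `θ = k / (r + k)` maps `(0, ∞)` onto `(0, 1)`, and `θ ↦ ∑ i, a i ^ θ`
decreases from `card ι > 1` at `0` to `∑ i, a i < 1` at `1`. -/
theorem existsUnique_dim {ι : Type*} [Fintype ι] {a : ι → ℝ}
    (h0 : ∀ i, 0 < a i) (h1 : ∀ i, a i < 1) (hcard : 1 < Fintype.card ι) (hsum : ∑ i, a i < 1)
    {r : ℝ} (hr : 0 < r) :
    ∃! k : ℝ, 0 < k ∧ ∑ i, a i ^ (k / (r + k)) = 1 := by
  have : Nonempty ι := Fintype.card_pos_iff.1 (by omega)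
  have hanti := sum_rpow_strictAnti h0 h1
  have hcont : Continuous fun θ : ℝ => ∑ i, a i ^ θ :=
    continuous_finsetSum _ fun i _ => Real.continuous_const_rpow (h0 i).ne'
  obtain ⟨θ, hθ, hθ1⟩ := intermediate_value_Icc' (zero_le_one' ℝ) hcont.continuousOn
    (show (1 : ℝ) ∈ _ from by
      refine ⟨by simpa using hsum.le, ?_⟩
      simp only [Real.rpow_zero, Finset.sum_const, Finset.card_univ, nsmul_eq_mul, mul_one]
      exact_mod_cast hcard.le)
  simp only at hθ1
  have hθ0 : 0 < θ := by
    refine lt_of_le_of_ne hθ.1 fun h => ?_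
    subst h
    simp only [Real.rpow_zero, Finset.sum_const, Finset.card_univ, nsmul_eq_mul, mul_one] at hθ1
    have : Fintype.card ι = 1 := by exact_mod_cast hθ1
    omega
  have hθ2 : 0 < 1 - θ := by
    refine sub_pos.2 (lt_of_le_of_ne hθ.2 fun h => ?_)
    subst h
    simp only [Real.rpow_one] at hθ1
    linarith
  have hk : r * θ / (1 - θ) / (r + r * θ / (1 - θ)) = θ := by
    have : r + r * θ / (1 - θ) = r / (1 - θ) := by field_simp; ring
    rw [this]
    field_simp
  refine ⟨r * θ / (1 - θ), ⟨by positivity, by rw [hk]; exact hθ1⟩, ?_⟩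
  rintro k ⟨hk0, hk1⟩
  have hkθ : k / (r + k) = θ := hanti.injective (hk1.trans hθ1.symm)
  have : r + k ≠ 0 := by positivity
  rw [← hkθ]
  field_simp
  rw [add_sub_cancel_right, div_self hr.ne']

/-- The elements `q i = a i ^ (k / (r + k))` satisfy `a i = q i ^ (1 + r / k)`. -/
theorem rpow_dim_rpow {a r k : ℝ} (ha : 0 < a) (hr : 0 < r) (hk : 0 < k) :
    (a ^ (k / (r + k))) ^ (1 + r / k) = a := by
  have : k / (r + k) * (1 + r / k) = 1 := by field_simp; ring
  rw [← Real.rpow_mul ha.le, this, Real.rpow_one]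

/-! ### Upper bound for the quantization error -/

theorem infEDist_image_rpow_le {Y : Type*} [MetricSpace Y] {f : Y → Y} {c r : ℝ} (hc : 0 < c) (hr : 0 < r)
    (h : ∀ x y, dist (f x) (f y) ≤ c * dist x y) (A : Set Y) (x : Y) :
    Metric.infEDist (f x) (f '' A) ^ r ≤ ENNReal.ofReal (c ^ r) * Metric.infEDist x A ^ r := by
  rw [← ENNReal.ofReal_rpow_of_pos hc, ← ENNReal.mul_rpow_of_nonneg _ _ hr.le]
  refine ENNReal.rpow_le_rpow ?_ hr.le
  rw [Metric.infEDist.eq_def x, ENNReal.mul_iInf_of_ne (by simpa using hc) ENNReal.ofReal_ne_top]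
  refine le_iInf fun y => ?_
  rw [ENNReal.mul_iInf_of_ne (by simpa using hc) ENNReal.ofReal_ne_top]
  refine le_iInf fun hy => ?_
  refine (Metric.infEDist_le_edist_of_mem (Set.mem_image_of_mem f hy)).trans ?_
  rw [edist_dist, edist_dist, ← ENNReal.ofReal_mul hc.le]
  exact ENNReal.ofReal_le_ofReal (h x y)

section

variable {Y : Type*} [MetricSpace Y] [MeasurableSpace Y] [BorelSpace Y]

theorem measurable_of_dist_le {f : Y → Y} {c : ℝ} (h : ∀ x y, dist (f x) (f y) ≤ c * dist x y) :
    Measurable f :=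
  (LipschitzWith.of_dist_le' h).continuous.measurable

/-- The parameter `x` is a real-valued budget of points. A budget `x ≤ 1` is spent on one point; a
budget `x > 1` is divided among the pieces `f i (E)` in the proportions `q i`, chosen so that the
bound `C * x ^ (-α)` reproduces itself. -/
theorem exists_finset_lintegral_infEDist_le {ι : Type*} [Fintype ι] {f : ι → Y → Y}
    {p c q : ι → ℝ} {μ : Measure Y} {r α C q0 ρ : ℝ} (hr : 0 < r) (hα : 0 ≤ α)
    (hμ : ∀ F : Y → ℝ≥0∞, Measurable F →
      ∫⁻ x, F x ∂μ = ∑ i, ENNReal.ofReal (p i) * ∫⁻ x, F (f i x) ∂μ)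
    (hf : ∀ i x y, dist (f i x) (f i y) ≤ c i * dist x y)
    (hp : ∀ i, 0 < p i) (hc : ∀ i, 0 < c i)
    (hq0 : 0 < q0) (hq : ∀ i, q0 ≤ q i) (hρ : ∀ i, q i ≤ ρ) (hρ1 : ρ < 1) (hsum : ∑ i, q i = 1)
    (hpc : ∀ i, p i * c i ^ r = q i ^ (1 + α)) (hC : 0 ≤ C)
    (hbase : ∃ a : Y, ∫⁻ x, Metric.infEDist x {a} ^ r ∂μ ≤ ENNReal.ofReal C) {x : ℝ}
    (hx : q0 ≤ x) :
    ∃ A : Finset Y, (A.card : ℝ) ≤ x / q0 ∧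
      ∫⁻ y, Metric.infEDist y (A : Set Y) ^ r ∂μ ≤ ENNReal.ofReal (C * x ^ (-α)) := by
  classical
  have key : ∀ (m : ℕ) (x : ℝ), q0 ≤ x → x * ρ ^ m ≤ 1 →
      ∃ A : Finset Y, (A.card : ℝ) ≤ x / q0 ∧
        ∫⁻ y, Metric.infEDist y (A : Set Y) ^ r ∂μ ≤ ENNReal.ofReal (C * x ^ (-α)) := by
    have small : ∀ x : ℝ, q0 ≤ x → x ≤ 1 → ∃ A : Finset Y, (A.card : ℝ) ≤ x / q0 ∧
        ∫⁻ y, Metric.infEDist y (A : Set Y) ^ r ∂μ ≤ ENNReal.ofReal (C * x ^ (-α)) := by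
      intro x hx hx1
      obtain ⟨a, ha⟩ := hbase
      refine ⟨{a}, ?_, ?_⟩
      · simpa using (one_le_div hq0).2 hx
      · refine (by simpa using ha : _ ≤ ENNReal.ofReal C).trans (ENNReal.ofReal_le_ofReal ?_)
        exact le_mul_of_one_le_right hC
          (Real.one_le_rpow_of_pos_of_le_one_of_nonpos (hq0.trans_le hx) hx1 (by linarith))
    intro m
    induction m with
    | zero => exact fun x hx hx1 => small x hx (by simpa using hx1)
    | succ m ih =>
      intro x hx hxm
      rcases le_or_gt x 1 with h1 | h1
      · exact small x hx h1
      have hx0 : 0 < x := by linarith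
      have hρ0 : 0 ≤ ρ := by
        obtain ⟨i, -, -⟩ := Finset.exists_ne_zero_of_sum_ne_zero (hsum.trans_ne one_ne_zero)
        exact hq0.le.trans ((hq i).trans (hρ i))
      have hi : ∀ i, ∃ A : Finset Y, (A.card : ℝ) ≤ x * q i / q0 ∧
          ∫⁻ y, Metric.infEDist y (A : Set Y) ^ r ∂μ ≤
            ENNReal.ofReal (C * (x * q i) ^ (-α)) := fun i => by
        refine ih _ ?_ ?_
        · nlinarith [hq i]
        · refine le_trans ?_ hxm
          rw [pow_succ', ← mul_assoc]
          exact mul_le_mul_of_nonneg_right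
            (mul_le_mul_of_nonneg_left (hρ i) hx0.le) (pow_nonneg hρ0 m)
      choose A hAcard hA using hi
      refine ⟨Finset.univ.biUnion fun i => (A i).image (f i), ?_, ?_⟩
      · calc ((Finset.univ.biUnion fun i => (A i).image (f i)).card : ℝ)
            ≤ ∑ i, ((A i).card : ℝ) := by
              exact_mod_cast Finset.card_biUnion_le.trans
                (Finset.sum_le_sum fun i _ => Finset.card_image_le)
          _ ≤ ∑ i, x * q i / q0 := Finset.sum_le_sum fun i _ => hAcard i
          _ = x / q0 := by rw [← Finset.sum_div, ← Finset.mul_sum, hsum, mul_one]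
      · rw [hμ _ (measurable_infEDist.pow_const r)]
        calc _ ≤ ∑ i, ENNReal.ofReal (q i * (C * x ^ (-α))) := by
              refine Finset.sum_le_sum fun i _ => ?_
              have hqi : 0 < q i := hq0.trans_le (hq i)
              calc _ ≤ ENNReal.ofReal (p i) * ∫⁻ y, ENNReal.ofReal (c i ^ r) *
                    Metric.infEDist y (A i : Set Y) ^ r ∂μ := by
                    gcongr with y
                    refine le_trans (ENNReal.rpow_le_rpow (Metric.infEDist_anti ?_) hr.le)
                      (infEDist_image_rpow_le (hc i) hr (hf i) _ y)
                    rw [← Finset.coe_image]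
                    exact_mod_cast Finset.subset_biUnion_of_mem (fun i => (A i).image (f i))
                      (Finset.mem_univ i)
                _ = ENNReal.ofReal (p i) * (ENNReal.ofReal (c i ^ r) *
                    ∫⁻ y, Metric.infEDist y (A i : Set Y) ^ r ∂μ) := by
                    rw [lintegral_const_mul _ (measurable_infEDist.pow_const r)]
                _ ≤ ENNReal.ofReal (p i) * (ENNReal.ofReal (c i ^ r) *
                    ENNReal.ofReal (C * (x * q i) ^ (-α))) := by gcongr; exact hA i
                _ = ENNReal.ofReal (q i * (C * x ^ (-α))) := by
                    have := (hc i).le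
                    rw [← ENNReal.ofReal_mul (by positivity), ← ENNReal.ofReal_mul (hp i).le,
                      ← mul_assoc, hpc i, Real.mul_rpow hx0.le hqi.le, Real.rpow_neg hqi.le,
                      Real.rpow_add hqi, Real.rpow_one]
                    congr 1
                    field_simp
          _ = ENNReal.ofReal (C * x ^ (-α)) := by
              rw [← ENNReal.ofReal_sum_of_nonneg, ← Finset.sum_mul, hsum, one_mul]
              intro i _
              have : 0 < q i := hq0.trans_le (hq i)
              positivity
  obtain ⟨i, -, -⟩ := Finset.exists_ne_zero_of_sum_ne_zero (hsum.trans_ne one_ne_zero)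
  have hρ0 : 0 < ρ := hq0.trans_le ((hq i).trans (hρ i))
  have hx0 : 0 < x := hq0.trans_le hx
  obtain ⟨m, hm⟩ := exists_pow_lt_of_lt_one (inv_pos.2 hx0) hρ1
  refine key m x hx ?_
  calc x * ρ ^ m ≤ x * x⁻¹ := by gcongr
    _ = 1 := mul_inv_cancel₀ hx0.ne'

/-! ### Lower bound for the quantization error -/

theorem ofReal_sum_le_sum_ofReal {ι : Type*} (t : Finset ι) (u : ι → ℝ) :
    ENNReal.ofReal (∑ i ∈ t, u i) ≤ ∑ i ∈ t, ENNReal.ofReal (u i) := by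
  classical
  induction t using Finset.induction_on with
  | empty => simp
  | insert a t ha ih =>
    rw [Finset.sum_insert ha, Finset.sum_insert ha]
    exact ENNReal.ofReal_add_le.trans (by gcongr)

/-- The lower bound for a strongly separated system: the sets `g v (E)` are pairwise at distance at
least `2 * τ`. The parameter `x` plays the role of the number of separated pieces under
consideration, of which at most `A.card` have a point of `A` nearby; the right-hand side adds up the
cost of the others. The bound is affine in `A.card`, and this is what makes it additive under
distributing the points of `A` over the pieces. The statement is for an arbitrary map `φ` that is
Lipschitz from below, since points of `A` need not lie in the range of the maps `g v` and so cannot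
be pulled back by them. -/
theorem le_lintegral_min_infEDist {ι : Type*} [Fintype ι] [Nonempty ι] {g : ι → Y → Y}
    {P S q : ι → ℝ} {μ : Measure Y} [IsProbabilityMeasure μ] {E : Set Y} {r α q0 ρ τ : ℝ}
    (hr : 0 < r) (hα : 0 ≤ α)
    (hμE : ∀ᵐ x ∂μ, x ∈ E)
    (hμ : ∀ F : Y → ℝ≥0∞, Measurable F →
      ∑ v, ENNReal.ofReal (P v) * ∫⁻ x, F (g v x) ∂μ ≤ ∫⁻ x, F x ∂μ)
    (hgm : ∀ v, Measurable (g v))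
    (hg : ∀ v x y, S v * dist x y ≤ dist (g v x) (g v y))
    (hP : ∀ v, 0 < P v) (hS : ∀ v, 0 < S v) (hS1 : ∀ v, S v ≤ 1)
    (hτ : 0 < τ)
    (hsep : ∀ v w, v ≠ w → ∀ x ∈ E, ∀ y ∈ E, 2 * τ ≤ dist (g v x) (g w y))
    (hq0 : 0 < q0) (hq : ∀ v, q0 ≤ q v) (hρ : ∀ v, q v ≤ ρ) (hρ1 : ρ < 1) (hsum : 1 ≤ ∑ v, q v)
    (hPS : ∀ v, P v * S v ^ r = q v ^ (1 + α)) {x : ℝ} (hx : q0 ≤ x)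
    {φ : Y → Y} {σ : ℝ} (hφm : Measurable φ) (hσ : 0 < σ)
    (hφ : ∀ x y, σ * dist x y ≤ dist (φ x) (φ y)) (A : Finset Y) :
    ENNReal.ofReal (τ ^ r * q0 ^ α * σ ^ r * (x - A.card) * x ^ (-(1 + α))) ≤
      ∫⁻ y, min (Metric.infEDist (φ y) (A : Set Y)) (ENNReal.ofReal (τ * σ)) ^ r ∂μ := by
  classical
  have small : ∀ x : ℝ, q0 ≤ x → x ≤ 1 → ∀ (φ : Y → Y) (σ : ℝ) (A : Finset Y), 0 < σ →
      ENNReal.ofReal (τ ^ r * q0 ^ α * σ ^ r * (x - A.card) * x ^ (-(1 + α))) ≤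
        ∫⁻ y, min (Metric.infEDist (φ y) (A : Set Y)) (ENNReal.ofReal (τ * σ)) ^ r ∂μ := by
    intro x hx hx1 φ σ A hσ
    have hx0 : 0 < x := hq0.trans_le hx
    rcases A.eq_empty_or_nonempty with rfl | hA
    · simp only [Finset.card_empty, Nat.cast_zero, sub_zero, Finset.coe_empty,
        Metric.infEDist_empty, le_top, inf_of_le_right, lintegral_const, measure_univ, mul_one]
      rw [ENNReal.ofReal_rpow_of_pos (by positivity)]
      refine ENNReal.ofReal_le_ofReal ?_
      rw [Real.mul_rpow hτ.le hσ.le]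
      have h1 : q0 ^ α ≤ x ^ α := Real.rpow_le_rpow hq0.le hx hα
      have h2 : x * x ^ (-(1 + α)) = (x ^ α)⁻¹ := by
        rw [Real.rpow_neg hx0.le, Real.rpow_add hx0, Real.rpow_one]
        field_simp
      have h3 : q0 ^ α * (x ^ α)⁻¹ ≤ 1 := by
        rw [← div_eq_mul_inv]
        exact div_le_one_of_le₀ h1 (by positivity)
      calc τ ^ r * q0 ^ α * σ ^ r * x * x ^ (-(1 + α))
          = τ ^ r * σ ^ r * (q0 ^ α * (x * x ^ (-(1 + α)))) := by ring
        _ ≤ τ ^ r * σ ^ r := by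
          rw [h2]
          exact mul_le_of_le_one_right (by positivity) h3
    · rw [ENNReal.ofReal_of_nonpos]
      · exact zero_le
      · have : (1 : ℝ) ≤ A.card := by exact_mod_cast hA.card_pos
        refine mul_nonpos_of_nonpos_of_nonneg
          (mul_nonpos_of_nonneg_of_nonpos (by positivity) (by linarith)) (by positivity)
  have key : ∀ (m : ℕ) (x : ℝ), q0 ≤ x → x * ρ ^ m ≤ 1 → ∀ (φ : Y → Y) (σ : ℝ) (A : Finset Y),
      Measurable φ → 0 < σ → (∀ x y, σ * dist x y ≤ dist (φ x) (φ y)) →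
      ENNReal.ofReal (τ ^ r * q0 ^ α * σ ^ r * (x - A.card) * x ^ (-(1 + α))) ≤
        ∫⁻ y, min (Metric.infEDist (φ y) (A : Set Y)) (ENNReal.ofReal (τ * σ)) ^ r ∂μ := by
    intro m
    induction m with
    | zero => exact fun x hx hx1 φ σ A _ hσ _ => small x hx (by simpa using hx1) φ σ A hσ
    | succ m ih =>
      intro x hx hxm φ σ A hφm hσ hφ
      rcases le_or_gt x 1 with h1 | h1
      · exact small x hx h1 φ σ A hσ
      have hx0 : 0 < x := by linarith
      have hρ0 : 0 ≤ ρ := by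
        obtain ⟨i⟩ := ‹Nonempty ι›
        exact hq0.le.trans ((hq i).trans (hρ i))
      -- the points of `A` near the image of the piece `g v (E)`
      let B : ι → Finset Y := fun v => A.filter fun a => ∃ y ∈ E, dist (φ (g v y)) a < τ * σ
      have hBdisj : ∀ v w, v ≠ w → Disjoint (B v) (B w) := by
        intro v w hvw
        rw [Finset.disjoint_left]
        intro a hav haw
        obtain ⟨y, hy, hya⟩ := (Finset.mem_filter.1 hav).2
        obtain ⟨z, hz, hza⟩ := (Finset.mem_filter.1 haw).2
        have h2 := hφ (g v y) (g w z)
        have h3 := hsep v w hvw y hy z hz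
        have h4 := dist_triangle_right (φ (g v y)) (φ (g w z)) a
        nlinarith
      have hBcard : ∑ v, ((B v).card : ℝ) ≤ A.card := by
        have : ∑ v, (B v).card ≤ A.card := by
          rw [← Finset.card_biUnion fun v _ w _ h => hBdisj v w h]
          exact Finset.card_le_card (Finset.biUnion_subset.2 fun v _ => Finset.filter_subset _ _)
        exact_mod_cast this
      have hmeas : Measurable fun y =>
          min (Metric.infEDist (φ y) (A : Set Y)) (ENNReal.ofReal (τ * σ)) ^ r :=
        ((measurable_infEDist.comp hφm).min measurable_const).pow_const r
      refine le_trans ?_ (hμ _ hmeas)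
      have hv : ∀ v, ENNReal.ofReal (τ ^ r * q0 ^ α * (σ * S v) ^ r * (x * q v - (B v).card) *
            (x * q v) ^ (-(1 + α))) ≤
          ∫⁻ y, min (Metric.infEDist (φ (g v y)) (A : Set Y)) (ENNReal.ofReal (τ * σ)) ^ r ∂μ := by
        intro v
        refine le_trans (ih (x * q v) ?_ ?_ (φ ∘ g v) (σ * S v) (B v) (hφm.comp (hgm v))
          (mul_pos hσ (hS v)) ?_) ?_
        · nlinarith [hq v]
        · refine le_trans ?_ hxm
          rw [pow_succ', ← mul_assoc]
          exact mul_le_mul_of_nonneg_right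
            (mul_le_mul_of_nonneg_left (hρ v) hx0.le) (pow_nonneg hρ0 m)
        · intro y z
          calc σ * S v * dist y z = σ * (S v * dist y z) := by ring
            _ ≤ σ * dist (g v y) (g v z) := by gcongr; exact hg v y z
            _ ≤ _ := hφ _ _
        · refine lintegral_mono_ae ?_
          filter_upwards [hμE] with y hy
          refine ENNReal.rpow_le_rpow (le_min ?_ ?_) hr.le
          · refine Metric.le_infEDist.2 fun a ha => ?_
            by_cases hya : dist (φ (g v y)) a < τ * σ
            · exact (min_le_left _ _).trans
                (Metric.infEDist_le_edist_of_mem (Finset.mem_filter.2 ⟨ha, y, hy, hya⟩))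
            · refine (min_le_right _ _).trans ?_
              rw [edist_dist]
              refine ENNReal.ofReal_le_ofReal (le_trans ?_ (not_lt.1 hya))
              have := hS1 v
              gcongr
              nlinarith
          · refine (min_le_right _ _).trans (ENNReal.ofReal_le_ofReal ?_)
            have := hS1 v
            gcongr
            nlinarith
      have hterm : ∀ v, P v * (τ ^ r * q0 ^ α * (σ * S v) ^ r * (x * q v - (B v).card) *
            (x * q v) ^ (-(1 + α))) =
          τ ^ r * q0 ^ α * σ ^ r * (x * q v - (B v).card) * x ^ (-(1 + α)) := by
        intro v
        have hqv : 0 < q v := hq0.trans_le (hq v)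
        rw [Real.mul_rpow hσ.le (hS v).le, Real.mul_rpow hx0.le hqv.le, Real.rpow_neg hqv.le]
        have h5 : 0 < q v ^ (1 + α) := by positivity
        calc _ = τ ^ r * q0 ^ α * σ ^ r * (x * q v - (B v).card) * x ^ (-(1 + α)) *
              ((P v * S v ^ r) * (q v ^ (1 + α))⁻¹) := by ring
          _ = _ := by rw [hPS v, mul_inv_cancel₀ h5.ne', mul_one]
      calc ENNReal.ofReal (τ ^ r * q0 ^ α * σ ^ r * (x - A.card) * x ^ (-(1 + α)))
          ≤ ENNReal.ofReal (∑ v, P v * (τ ^ r * q0 ^ α * (σ * S v) ^ r *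
              (x * q v - (B v).card) * (x * q v) ^ (-(1 + α)))) := by
            refine ENNReal.ofReal_le_ofReal ?_
            simp only [hterm]
            rw [← Finset.sum_mul, ← Finset.mul_sum, Finset.sum_sub_distrib, ← Finset.mul_sum]
            gcongr
            nlinarith
        _ ≤ ∑ v, ENNReal.ofReal (P v * (τ ^ r * q0 ^ α * (σ * S v) ^ r *
              (x * q v - (B v).card) * (x * q v) ^ (-(1 + α)))) := ofReal_sum_le_sum_ofReal _ _
        _ ≤ _ := Finset.sum_le_sum fun v _ => by
            rw [ENNReal.ofReal_mul (hP v).le]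
            gcongr
            exact hv v
  obtain ⟨i⟩ := ‹Nonempty ι›
  have hρ0 : 0 < ρ := hq0.trans_le ((hq i).trans (hρ i))
  have hx0 : 0 < x := hq0.trans_le hx
  obtain ⟨m, hm⟩ := exists_pow_lt_of_lt_one (inv_pos.2 hx0) hρ1
  refine key m x hx ?_ φ σ A hφm hσ hφ
  calc x * ρ ^ m ≤ x * x⁻¹ := by gcongr
    _ = 1 := mul_inv_cancel₀ hx0.ne'

end

/-! ### Words -/

/-- The composition `f (w 0) ∘ f (w 1) ∘ ⋯ ∘ f (w (n - 1))` along a word `w` of length `n`. -/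
def wordMap {Y ι : Type*} (f : ι → Y → Y) : (n : ℕ) → (Fin n → ι) → Y → Y
  | 0, _ => id
  | n + 1, w => f (w 0) ∘ wordMap f n (Fin.tail w)

section

variable {Y ι : Type*} {f : ι → Y → Y}

theorem wordMap_succ (n : ℕ) (w : Fin (n + 1) → ι) (x : Y) :
    wordMap f (n + 1) w x = f (w 0) (wordMap f n (Fin.tail w) x) := rfl

theorem le_dist_wordMap [MetricSpace Y] {s : ι → ℝ} (hs : ∀ i, 0 < s i)
    (hf : ∀ i x y, s i * dist x y ≤ dist (f i x) (f i y)) (n : ℕ) (w : Fin n → ι) (x y : Y) :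
    (∏ j, s (w j)) * dist x y ≤ dist (wordMap f n w x) (wordMap f n w y) := by
  induction n with
  | zero => simp [wordMap]
  | succ n ih =>
    rw [Fin.prod_univ_succ, mul_assoc]
    refine le_trans ?_ (hf _ _ _)
    exact mul_le_mul_of_nonneg_left (ih (Fin.tail w)) (hs _).le

theorem dist_wordMap_le [MetricSpace Y] {K : ℝ} (hK : 0 ≤ K)
    (hf : ∀ i x y, dist (f i x) (f i y) ≤ K * dist x y) (n : ℕ) (w : Fin n → ι) (x y : Y) :
    dist (wordMap f n w x) (wordMap f n w y) ≤ K ^ n * dist x y := by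
  induction n with
  | zero => simp [wordMap]
  | succ n ih =>
    rw [pow_succ', mul_assoc]
    exact (hf _ _ _).trans (mul_le_mul_of_nonneg_left (ih (Fin.tail w)) hK)

theorem measurable_wordMap [MeasurableSpace Y] (hf : ∀ i, Measurable (f i)) (n : ℕ)
    (w : Fin n → ι) : Measurable (wordMap f n w) := by
  induction n with
  | zero => exact measurable_id
  | succ n ih => exact (hf _).comp (ih _)

theorem wordMap_mem {E : Set Y} (hf : ∀ i, ∀ x ∈ E, f i x ∈ E) (n : ℕ) (w : Fin n → ι) :
    ∀ x ∈ E, wordMap f n w x ∈ E := by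
  induction n with
  | zero => exact fun x hx => hx
  | succ n ih => exact fun x hx => hf _ _ (ih _ x hx)

theorem exists_wordMap_eq {E : Set Y} (hE : ∀ x ∈ E, ∃ i, ∃ y ∈ E, f i y = x) (n : ℕ) :
    ∀ x ∈ E, ∃ w : Fin n → ι, ∃ y ∈ E, wordMap f n w y = x := by
  induction n with
  | zero => exact fun x hx => ⟨Fin.elim0, x, hx, rfl⟩
  | succ n ih =>
    intro x hx
    obtain ⟨i, y, hy, rfl⟩ := hE x hx
    obtain ⟨w, z, hz, rfl⟩ := ih y hy
    exact ⟨Fin.cons i w, z, hz, by simp [wordMap_succ]⟩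

/-- Under the open set condition distinct words of the same length have disjoint images of `O`. -/
theorem wordMap_ne {O : Set Y} (hinj : ∀ i, Function.Injective (f i))
    (hO : ∀ i, ∀ x ∈ O, f i x ∈ O)
    (hdisj : ∀ i j, i ≠ j → ∀ x ∈ O, ∀ y ∈ O, f i x ≠ f j y) (n : ℕ) :
    ∀ v w : Fin n → ι, v ≠ w → ∀ x ∈ O, ∀ y ∈ O, wordMap f n v x ≠ wordMap f n w y := by
  induction n with
  | zero => exact fun v w h => (h (Subsingleton.elim v w)).elim
  | succ n ih =>
    intro v w hvw x hx y hy h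
    rw [wordMap_succ, wordMap_succ] at h
    by_cases h0 : v 0 = w 0
    · rw [h0] at h
      refine ih (Fin.tail v) (Fin.tail w) (fun ht => hvw ?_) x hx y hy (hinj _ h)
      rw [← Fin.cons_self_tail v, ← Fin.cons_self_tail w, ht, h0]
    · exact hdisj _ _ h0 _ (wordMap_mem hO n _ x hx) _ (wordMap_mem hO n _ y hy) h

theorem lintegral_eq_sum_wordMap [MeasurableSpace Y] [Fintype ι] {μ : Measure Y} {p : ι → ℝ}
    (hp : ∀ i, 0 ≤ p i) (hf : ∀ i, Measurable (f i))
    (hμ : ∀ F : Y → ℝ≥0∞, Measurable F →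
      ∫⁻ x, F x ∂μ = ∑ i, ENNReal.ofReal (p i) * ∫⁻ x, F (f i x) ∂μ) (n : ℕ) :
    ∀ F : Y → ℝ≥0∞, Measurable F → ∫⁻ x, F x ∂μ =
      ∑ w : Fin n → ι, ENNReal.ofReal (∏ j, p (w j)) * ∫⁻ x, F (wordMap f n w x) ∂μ := by
  induction n with
  | zero => intro F _; simp [wordMap]
  | succ n ih =>
    intro F hF
    rw [hμ F hF, ← (Fin.consEquiv fun _ => ι).sum_comp, Fintype.sum_prod_type]
    refine Finset.sum_congr rfl fun i _ => ?_
    rw [ih (fun x => F (f i x)) (hF.comp (hf i)), Finset.mul_sum]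
    refine Finset.sum_congr rfl fun w _ => ?_
    rw [← mul_assoc, ← ENNReal.ofReal_mul (hp i), Fin.prod_univ_succ]
    simp [wordMap_succ, Fin.consEquiv]

theorem sum_prod_mul_prod_rpow [Fintype ι] {p s : ι → ℝ} (hp : ∀ i, 0 < p i) (hs : ∀ i, 0 < s i)
    (r θ : ℝ) (n : ℕ) :
    ∑ w : Fin n → ι, ((∏ j, p (w j)) * (∏ j, s (w j)) ^ r) ^ θ =
      (∑ i, (p i * s i ^ r) ^ θ) ^ n := by
  rw [Fintype.sum_pow]
  refine Finset.sum_congr rfl fun w _ => ?_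
  rw [← Real.finsetProd_rpow _ _ fun j _ => (hs _).le, ← Finset.prod_mul_distrib,
    Real.finsetProd_rpow _ _ fun j _ => mul_nonneg (hp _).le (Real.rpow_nonneg (hs _).le r)]

end

theorem exists_pos_forall_le_dist {Y ι : Type*} [MetricSpace Y] [Finite ι] {g : ι → Y → Y}
    {E : Set Y} (hE : IsCompact E) (hg : ∀ v, Continuous (g v))
    (hne : ∀ v w, v ≠ w → ∀ x ∈ E, ∀ y ∈ E, g v x ≠ g w y) :
    ∃ τ > 0, ∀ v w, v ≠ w → ∀ x ∈ E, ∀ y ∈ E, 2 * τ ≤ dist (g v x) (g w y) := by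
  have h : ∀ v w, ∀ᶠ τ : ℝ in 𝓝[>] 0,
      v ≠ w → ∀ x ∈ E, ∀ y ∈ E, 2 * τ ≤ dist (g v x) (g w y) := by
    intro v w
    by_cases hvw : v = w
    · exact Eventually.of_forall fun τ h => (h hvw).elim
    have hK := hE.prod hE
    rcases (E ×ˢ E).eq_empty_or_nonempty with h0 | h0
    · refine Eventually.of_forall fun τ _ x hx y hy => ?_
      exact ((Set.eq_empty_iff_forall_notMem.1 h0) (x, y) ⟨hx, hy⟩).elim
    obtain ⟨z, hz, hmin⟩ := hK.exists_isMinOn h0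
      (((hg v).comp continuous_fst).dist ((hg w).comp continuous_snd)).continuousOn
    have hpos : 0 < dist (g v z.1) (g w z.2) := dist_pos.2 (hne v w hvw _ hz.1 _ hz.2)
    filter_upwards [Ioo_mem_nhdsGT (half_pos hpos)] with τ hτ _ x hx y hy
    have h1 : dist (g v z.1) (g w z.2) ≤ dist (g v x) (g w y) := hmin (Set.mk_mem_prod hx hy)
    linarith [hτ.2]
  obtain ⟨τ, hτ, hτ0⟩ := ((eventually_all.2 fun v => eventually_all.2 fun w => h v w).and
    self_mem_nhdsWithin).exists
  exact ⟨τ, hτ0, hτ⟩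

/-! ### Power-law bounds for the quantization error of an invariant measure -/

section

variable {Y : Type*} [MetricSpace Y] [MeasurableSpace Y] [BorelSpace Y] {N : ℕ}
  {W : WeightedIFS Y N} {E : Set Y} {μ : Measure Y}

theorem WeightedIFS.IsInvariantMeasure.lintegral_eq (hμ : W.IsInvariantMeasure E μ)
    (F : Y → ℝ≥0∞) (hF : Measurable F) :
    ∫⁻ x, F x ∂μ = ∑ i, ENNReal.ofReal (W.weight i) * ∫⁻ x, F (W.map i x) ∂μ := by
  conv_lhs => rw [hμ.2.2]
  rw [lintegral_finsetSum_measure]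
  refine Finset.sum_congr rfl fun i _ => ?_
  obtain ⟨K, hK⟩ := W.contracting i
  rw [lintegral_smul_measure, lintegral_map hF hK.2.continuous.measurable, smul_eq_mul]

theorem exists_bounds {ι : Type*} [Finite ι] [Nonempty ι] {q : ι → ℝ} (h0 : ∀ i, 0 < q i)
    (h1 : ∀ i, q i < 1) :
    ∃ q0 ρ : ℝ, 0 < q0 ∧ ρ < 1 ∧ (∀ i, q0 ≤ q i) ∧ ∀ i, q i ≤ ρ := by
  obtain ⟨a, ha⟩ := Finite.exists_min q
  obtain ⟨b, hb⟩ := Finite.exists_max q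
  exact ⟨q a, q b, h0 a, h1 b, ha, hb⟩

/-- The power law behind the upper bound for the dimension; it needs no open set condition. -/
theorem quantizationError_le (hN : 2 ≤ N) (hE : W.IsAttractor E) (hμ : W.IsInvariantMeasure E μ)
    {c : Fin N → ℝ} (hc0 : ∀ i, 0 < c i) (hc1 : ∀ i, c i < 1)
    (hc : ∀ i x y, dist (W.map i x) (W.map i y) ≤ c i * dist x y) {r l : ℝ} (hr : 0 < r)
    (hl : 0 < l) (hsum : ∑ i, (W.weight i * c i ^ r) ^ (l / (r + l)) = 1) :
    ∃ C > 0, ∀ n : ℕ, 1 ≤ n →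
      quantizationError μ r n ≤ ENNReal.ofReal (C * (n : ℝ) ^ (-(r / l))) := by
  have : NeZero N := ⟨by omega⟩
  have := hμ.1
  have hw : ∀ i, W.weight i ≤ 1 := fun i => W.weight_sum ▸
    Finset.single_le_sum (fun j _ => (W.weight_pos j).le) (Finset.mem_univ i)
  have ha0 : ∀ i, 0 < W.weight i * c i ^ r := fun i =>
    mul_pos (W.weight_pos i) (Real.rpow_pos_of_pos (hc0 i) r)
  have ha1 : ∀ i, W.weight i * c i ^ r < 1 := fun i =>
    mul_lt_one_of_nonneg_of_lt_one_right (hw i) (Real.rpow_nonneg (hc0 i).le r)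
      (Real.rpow_lt_one (hc0 i).le (hc1 i) hr)
  obtain ⟨q0, ρ, hq0, hρ1, hq, hρ⟩ := exists_bounds (q := fun i =>
      (W.weight i * c i ^ r) ^ (l / (r + l))) (fun i => Real.rpow_pos_of_pos (ha0 i) _)
    (fun i => Real.rpow_lt_one (ha0 i).le (ha1 i) (by positivity))
  obtain ⟨a, ha⟩ := hE.1
  have hbase : ∫⁻ x, Metric.infEDist x {a} ^ r ∂μ ≤
      ENNReal.ofReal ((Metric.diam E + 1) ^ r) := by
    calc _ ≤ ∫⁻ _, ENNReal.ofReal ((Metric.diam E + 1) ^ r) ∂μ := by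
          refine lintegral_mono_ae ?_
          filter_upwards [mem_ae_iff.2 hμ.2.1] with x hx
          have hd := Metric.diam_nonneg (s := E)
          rw [Metric.infEDist_singleton, edist_dist,
            ENNReal.ofReal_rpow_of_nonneg dist_nonneg hr.le]
          have := Metric.dist_le_diam_of_mem hE.2.1.isBounded hx ha
          gcongr
          linarith
      _ = _ := by simp
  have hdiam : 0 < Metric.diam E + 1 := by linarith [Metric.diam_nonneg (s := E)]
  refine ⟨(Metric.diam E + 1) ^ r * q0 ^ (-(r / l)), by positivity, fun n hn => ?_⟩
  have hn1 : (1 : ℝ) ≤ n := by exact_mod_cast hn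
  obtain ⟨A, hA, hAc⟩ := exists_finset_lintegral_infEDist_le hr (by positivity : 0 ≤ r / l)
    hμ.lintegral_eq hc W.weight_pos hc0 hq0 hq hρ hρ1 hsum
    (fun i => (rpow_dim_rpow (ha0 i) hr hl).symm) (by positivity) ⟨a, hbase⟩
    (x := q0 * n) (by nlinarith)
  refine (iInf₂_le A ?_).trans (hAc.trans_eq ?_)
  · rw [mul_div_cancel_left₀ _ hq0.ne'] at hA
    exact_mod_cast hA
  · rw [Real.mul_rpow hq0.le (by positivity), mul_assoc]

/-- The power law behind the lower bound for the dimension. The exponent `h` has to be below `k`,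
because passing to a strongly separated system loses a fixed factor of mass, which only a sum
`∑ i, (p i * s i ^ r) ^ (h / (r + h)) > 1` can make good. -/
theorem le_quantizationError (hN : 2 ≤ N) (hE : W.IsAttractor E)
    (hO : W.StrongOpenSetCondition E) (hμ : W.IsInvariantMeasure E μ)
    {s c : Fin N → ℝ} (hs0 : ∀ i, 0 < s i) (hs1 : ∀ i, s i < 1) (hc1 : ∀ i, c i < 1)
    (hs : ∀ i x y, s i * dist x y ≤ dist (W.map i x) (W.map i y))
    (hc : ∀ i x y, dist (W.map i x) (W.map i y) ≤ c i * dist x y) {r h k : ℝ} (hr : 0 < r)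
    (hh : 0 < h) (hk : h < k) (hsum : ∑ i, (W.weight i * s i ^ r) ^ (k / (r + k)) = 1) :
    ∃ b > 0, ∀ n : ℕ, 1 ≤ n →
      ENNReal.ofReal (b * (n : ℝ) ^ (-(r / h))) ≤ quantizationError μ r n := by
  have : NeZero N := ⟨by omega⟩
  have := hμ.1
  have hw : ∀ i, W.weight i ≤ 1 := fun i => W.weight_sum ▸
    Finset.single_le_sum (fun j _ => (W.weight_pos j).le) (Finset.mem_univ i)
  have ha0 : ∀ i, 0 < W.weight i * s i ^ r := fun i =>
    mul_pos (W.weight_pos i) (Real.rpow_pos_of_pos (hs0 i) r)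
  have ha1 : ∀ i, W.weight i * s i ^ r < 1 := fun i =>
    mul_lt_one_of_nonneg_of_lt_one_right (hw i) (Real.rpow_nonneg (hs0 i).le r)
      (Real.rpow_lt_one (hs0 i).le (hs1 i) hr)
  have hgt : 1 < ∑ i, (W.weight i * s i ^ r) ^ (h / (r + h)) :=
    hsum ▸ sum_rpow_strictAnti ha0 ha1 (div_add_lt_div_add hr hh hk)
  have hmeas : ∀ i, Measurable (W.map i) := fun i => measurable_of_dist_le (hc i)
  obtain ⟨K, hK0, hK1, hcK⟩ : ∃ K : ℝ, 0 ≤ K ∧ K < 1 ∧ ∀ i, c i ≤ K := by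
    obtain ⟨j, hj⟩ := Finite.exists_max c
    exact ⟨max 0 (c j), le_max_left _ _, max_lt one_pos (hc1 j),
      fun i => (hj i).trans (le_max_right _ _)⟩
  have hKlip : ∀ i x y, dist (W.map i x) (W.map i y) ≤ K * dist x y := fun i x y =>
    (hc i x y).trans (mul_le_mul_of_nonneg_right (hcK i) dist_nonneg)
  obtain ⟨O, hOo, -, hOmap, hOdisj, z, hzO, hzE⟩ := hO
  have hEmap : ∀ i, ∀ x ∈ E, W.map i x ∈ E := fun i x hx => by
    rw [hE.2.2]
    exact Set.mem_iUnion.2 ⟨i, x, hx, rfl⟩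
  have hEcov : ∀ x ∈ E, ∃ i, ∃ y ∈ E, W.map i y = x := fun x hx => by
    rw [hE.2.2] at hx
    exact Set.mem_iUnion.1 hx
  -- a word `u` whose cylinder set `f_u (E)` is contained in `O`
  obtain ⟨m, u, hm, hu⟩ : ∃ (m : ℕ) (u : Fin m → Fin N), 1 ≤ m ∧
      ∀ x ∈ E, wordMap W.map m u x ∈ O := by
    obtain ⟨ε, hε, hball⟩ := Metric.isOpen_iff.1 hOo z hzO
    have hd := Metric.diam_nonneg (s := E)
    obtain ⟨m, hm⟩ := exists_pow_lt_of_lt_one (div_pos hε (by linarith : 0 < Metric.diam E + 1)) hK1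
    obtain ⟨u, y, hy, rfl⟩ := exists_wordMap_eq hEcov (m + 1) z hzE
    refine ⟨m + 1, u, by omega, fun x hx => hball ?_⟩
    rw [Metric.mem_ball]
    calc _ ≤ K ^ (m + 1) * dist x y := dist_wordMap_le hK0 hKlip _ _ _ _
      _ ≤ K ^ m * (Metric.diam E + 1) := by
        gcongr ?_ * ?_
        · exact pow_le_pow_of_le_one hK0 hK1.le m.le_succ
        · linarith [Metric.dist_le_diam_of_mem hE.2.1.isBounded hx hy]
      _ < ε := (lt_div_iff₀ (by linarith)).1 hm
  have hpos : ∀ {t : Fin N → ℝ} (_ : ∀ i, 0 < t i) {n : ℕ} (w : Fin n → Fin N),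
      0 < ∏ j, t (w j) := fun ht n w => Finset.prod_pos fun j _ => ht _
  have hle1 : ∀ {t : Fin N → ℝ} (_ : ∀ i, 0 < t i) (_ : ∀ i, t i ≤ 1) {n : ℕ} (w : Fin n → Fin N),
      ∏ j, t (w j) ≤ 1 := fun ht ht1 n w =>
    Finset.prod_le_one (fun j _ => (ht _).le) fun j _ => ht1 _
  have hSu : ∏ j, s (u j) < 1 := by
    obtain ⟨j⟩ : Nonempty (Fin m) := ⟨⟨0, hm⟩⟩
    rw [← Finset.mul_prod_erase _ _ (Finset.mem_univ j)]
    exact mul_lt_one_of_nonneg_of_lt_one_left (hs0 _).le (hs1 _)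
      (Finset.prod_le_one (fun j _ => (hs0 _).le) fun j _ => (hs1 _).le)
  set pu := ∏ j, W.weight (u j) with hpu
  set su := ∏ j, s (u j) with hsu
  have hpu0 : 0 < pu := hpos W.weight_pos u
  have hsu0 : 0 < su := hpos hs0 u
  have hθ0 : 0 < h / (r + h) := by positivity
  -- the length `n` is so large that the loss of the factor belonging to `u` is compensated
  obtain ⟨n, hn⟩ := pow_unbounded_of_one_lt (((pu * su ^ r) ^ (h / (r + h)))⁻¹) hgt
  let g : (Fin n → Fin N) → Y → Y := fun v => wordMap W.map n v ∘ wordMap W.map m u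
  let P : (Fin n → Fin N) → ℝ := fun v => (∏ j, W.weight (v j)) * pu
  let S : (Fin n → Fin N) → ℝ := fun v => (∏ j, s (v j)) * su
  have hP0 : ∀ v, 0 < P v := fun v => mul_pos (hpos W.weight_pos v) hpu0
  have hS0 : ∀ v, 0 < S v := fun v => mul_pos (hpos hs0 v) hsu0
  have hP1 : ∀ v, P v ≤ 1 := fun v => mul_le_one₀ (hle1 W.weight_pos hw v) hpu0.le
    (hle1 W.weight_pos hw u)
  have hS1 : ∀ v, S v < 1 := fun v => mul_lt_one_of_nonneg_of_lt_one_right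
    (hle1 hs0 (fun i => (hs1 i).le) v) hsu0.le hSu
  have hPS0 : ∀ v, 0 < P v * S v ^ r := fun v =>
    mul_pos (hP0 v) (Real.rpow_pos_of_pos (hS0 v) r)
  have hPS1 : ∀ v, P v * S v ^ r < 1 := fun v =>
    mul_lt_one_of_nonneg_of_lt_one_right (hP1 v) (Real.rpow_nonneg (hS0 v).le r)
      (Real.rpow_lt_one (hS0 v).le (hS1 v) hr)
  have hQsum : 1 ≤ ∑ v, (P v * S v ^ r) ^ (h / (r + h)) := by
    have heq : ∀ v, (P v * S v ^ r) ^ (h / (r + h)) =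
        ((∏ j, W.weight (v j)) * (∏ j, s (v j)) ^ r) ^ (h / (r + h)) *
          (pu * su ^ r) ^ (h / (r + h)) := fun v => by
      have h1 := (hpos W.weight_pos v).le
      have h2 := (hpos hs0 v).le
      rw [← Real.mul_rpow (by positivity) (by positivity), Real.mul_rpow h2 hsu0.le]
      congr 1
      ring
    simp only [heq]
    rw [← Finset.sum_mul, sum_prod_mul_prod_rpow W.weight_pos hs0]
    have h3 : 0 < (pu * su ^ r) ^ (h / (r + h)) := by positivity
    rw [inv_eq_one_div, div_lt_iff₀ h3] at hn
    exact hn.le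
  have hglip : ∀ v x y, S v * dist x y ≤ dist (g v x) (g v y) := fun v x y => by
    calc S v * dist x y = (∏ j, s (v j)) * (su * dist x y) := mul_assoc _ _ _
      _ ≤ (∏ j, s (v j)) * dist (wordMap W.map m u x) (wordMap W.map m u y) :=
        mul_le_mul_of_nonneg_left (le_dist_wordMap hs0 hs _ _ _ _) (hpos hs0 v).le
      _ ≤ _ := le_dist_wordMap hs0 hs _ _ _ _
  have hcontw : ∀ n (w : Fin n → Fin N), Continuous (wordMap W.map n w) := fun n w =>
    (LipschitzWith.of_dist_le' (dist_wordMap_le hK0 hKlip n w)).continuous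
  have hinj : ∀ i, Function.Injective (W.map i) := fun i x y hxy => by
    have h1 := hs i x y
    rw [hxy, dist_self] at h1
    exact dist_le_zero.1 (nonpos_of_mul_nonpos_right h1 (hs0 i))
  obtain ⟨τ, hτ, hsep⟩ := exists_pos_forall_le_dist (g := g) hE.2.1
    (fun v => (hcontw n v).comp (hcontw m u)) fun v w hvw x hx y hy =>
      wordMap_ne hinj (fun i x hx => hOmap i ⟨x, hx, rfl⟩)
        (fun i j hij x hx y hy hxy => (Set.eq_empty_iff_forall_notMem.1 (hOdisj i j hij)) _
          ⟨⟨x, hx, rfl⟩, ⟨y, hy, hxy.symm⟩⟩) n v w hvw _ (hu x hx) _ (hu y hy)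
  have hμg : ∀ F : Y → ℝ≥0∞, Measurable F →
      ∑ v, ENNReal.ofReal (P v) * ∫⁻ x, F (g v x) ∂μ ≤ ∫⁻ x, F x ∂μ := fun F hF => by
    have hword := lintegral_eq_sum_wordMap (fun i => (W.weight_pos i).le) hmeas hμ.lintegral_eq
    rw [hword n F hF]
    refine Finset.sum_le_sum fun v _ => ?_
    rw [ENNReal.ofReal_mul (hpos W.weight_pos v).le, mul_assoc,
      hword m (fun x => F (wordMap W.map n v x)) (hF.comp (measurable_wordMap hmeas n v))]
    gcongr
    exact Finset.single_le_sum (f := fun w : Fin m → Fin N => ENNReal.ofReal (∏ j, W.weight (w j)) *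
      ∫⁻ x, F (wordMap W.map n v (wordMap W.map m w x)) ∂μ) (fun _ _ => zero_le)
      (Finset.mem_univ u)
  obtain ⟨q0, ρ, hq0, hρ1, hq, hρ⟩ := exists_bounds (q := fun v =>
      (P v * S v ^ r) ^ (h / (r + h))) (fun v => Real.rpow_pos_of_pos (hPS0 v) _)
    (fun v => Real.rpow_lt_one (hPS0 v).le (hPS1 v) hθ0)
  have hq01 : q0 < 1 :=
    (hq (Classical.arbitrary _)).trans_lt ((hρ (Classical.arbitrary _)).trans_lt hρ1)
  refine ⟨τ ^ r * q0 ^ (r / h) * 2 ^ (-(1 + r / h)), by positivity, fun n' hn' => ?_⟩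
  have hn1 : (1 : ℝ) ≤ n' := by exact_mod_cast hn'
  refine le_iInf₂ fun A hA => ?_
  have hA' : (A.card : ℝ) ≤ n' := by exact_mod_cast hA
  -- with `2 * n'` separated pieces at least `n'` of them have no point of `A` nearby
  have main := le_lintegral_min_infEDist hr (by positivity : 0 ≤ r / h) (mem_ae_iff.2 hμ.2.1) hμg
    (fun v => (measurable_wordMap hmeas n v).comp (measurable_wordMap hmeas m u)) hglip hP0 hS0
    (fun v => (hS1 v).le) hτ hsep hq0 hq hρ hρ1 hQsum
    (fun v => (rpow_dim_rpow (hPS0 v) hr hh).symm) (x := 2 * n') (by linarith) measurable_id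
    one_pos (fun x y => (one_mul _).le) A
  refine le_trans (ENNReal.ofReal_le_ofReal ?_) (main.trans (lintegral_mono fun y =>
    ENNReal.rpow_le_rpow (min_le_left _ _) hr.le))
  have hn0 : (0 : ℝ) < n' := by linarith
  calc τ ^ r * q0 ^ (r / h) * 2 ^ (-(1 + r / h)) * (n' : ℝ) ^ (-(r / h))
      = τ ^ r * q0 ^ (r / h) * 1 ^ r * n' * (2 * n') ^ (-(1 + r / h)) := by
        rw [Real.mul_rpow zero_le_two hn0.le, Real.one_rpow, neg_add (1 : ℝ),
          Real.rpow_add hn0, Real.rpow_neg_one]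
        field_simp
    _ ≤ _ := by
        gcongr
        linarith

end

/-! ### From power laws to quantization dimensions -/

theorem tendsto_log_div_add_log_div (a : ℝ) {h : ℝ} (hh : 0 < h) :
    Tendsto (fun n : ℕ => Real.log n / (a + Real.log n / h)) atTop (𝓝 h) := by
  have hlog : Tendsto (fun n : ℕ => Real.log n) atTop atTop :=
    Real.tendsto_log_atTop.comp tendsto_natCast_atTop_atTop
  have h1 : Tendsto (fun n : ℕ => (a / Real.log n + h⁻¹)⁻¹) atTop (𝓝 h) := by
    have := ((hlog.const_div_atTop a).add_const h⁻¹).inv₀ (by simpa using hh.ne')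
    simpa using this
  refine h1.congr' ?_
  filter_upwards [hlog.eventually_gt_atTop 0] with n hn
  have : a / Real.log n + h⁻¹ = (a + Real.log n / h) / Real.log n := by
    field_simp
  rw [this, inv_div]

section

variable {Y : Type*} [MetricSpace Y] [MeasurableSpace Y] {μ : Measure Y} {r : ℝ}

theorem quantizationRatio_eq {n : ℕ} (h0 : quantizationError μ r n ≠ 0)
    (htop : quantizationError μ r n ≠ ⊤) :
    quantizationRatio μ r n =
      ((Real.log n / (-Real.log (quantizationError μ r n).toReal / r) : ℝ) : EReal) := by
  rw [quantizationRatio, ENNReal.log_rpow, ENNReal.log_pos_real h0 htop, ← EReal.coe_mul,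
    ← EReal.coe_neg, ← EReal.coe_div]
  congr 2
  ring

variable {b C h l : ℝ}

/-- Two-sided power laws for the quantization errors give two-sided bounds for the ratio. The upper
law for the error also serves to make `-log e_{n,r}(μ)` positive, so that dividing by it is
monotone. -/
theorem eventually_quantizationRatio_mem (hr : 0 < r) (hb : 0 < b) (hC : 0 < C)
    (hh : 0 < h) (hl : 0 < l)
    (hlow : ∀ n : ℕ, 1 ≤ n → ENNReal.ofReal (b * (n : ℝ) ^ (-(r / h))) ≤ quantizationError μ r n)
    (hup : ∀ n : ℕ, 1 ≤ n → quantizationError μ r n ≤ ENNReal.ofReal (C * (n : ℝ) ^ (-(r / l)))) :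
    ∀ᶠ n : ℕ in atTop,
      ((Real.log n / (-Real.log b / r + Real.log n / h) : ℝ) : EReal) ≤ quantizationRatio μ r n ∧
      quantizationRatio μ r n ≤ ((Real.log n / (-Real.log C / r + Real.log n / l) : ℝ) : EReal) := by
  have hlog : Tendsto (fun n : ℕ => Real.log n) atTop atTop :=
    Real.tendsto_log_atTop.comp tendsto_natCast_atTop_atTop
  have hlogl := tendsto_atTop_add_const_left atTop (-Real.log C / r) (hlog.atTop_div_const hl)
  filter_upwards [eventually_ge_atTop 1, hlogl.eventually_gt_atTop 0] with n hn hpos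
  have hn0 : (0 : ℝ) < n := by exact_mod_cast hn
  have hlogn : 0 ≤ Real.log n := Real.log_nonneg (by exact_mod_cast hn)
  have hb' : 0 < b * (n : ℝ) ^ (-(r / h)) := by positivity
  have h0 : quantizationError μ r n ≠ 0 :=
    ((ENNReal.ofReal_pos.2 hb').trans_le (hlow n hn)).ne'
  have htop : quantizationError μ r n ≠ ⊤ := ((hup n hn).trans_lt ENNReal.ofReal_lt_top).ne
  rw [quantizationRatio_eq h0 htop]
  have h1 : b * (n : ℝ) ^ (-(r / h)) ≤ (quantizationError μ r n).toReal :=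
    (ENNReal.ofReal_le_iff_le_toReal htop).1 (hlow n hn)
  have h2 : (quantizationError μ r n).toReal ≤ C * (n : ℝ) ^ (-(r / l)) :=
    ENNReal.toReal_le_of_le_ofReal (by positivity) (hup n hn)
  have h3 := Real.log_le_log hb' h1
  have h4 := Real.log_le_log (ENNReal.toReal_pos h0 htop) h2
  rw [Real.log_mul hb.ne' (by positivity), Real.log_rpow hn0] at h3
  rw [Real.log_mul hC.ne' (by positivity), Real.log_rpow hn0] at h4
  have h5 : -Real.log (quantizationError μ r n).toReal / r ≤
      -Real.log b / r + Real.log n / h := by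
    rw [div_le_iff₀ hr]
    have : (-Real.log b / r + Real.log n / h) * r = -Real.log b + r / h * Real.log n := by
      field_simp
    linarith
  have h6 : -Real.log C / r + Real.log n / l ≤
      -Real.log (quantizationError μ r n).toReal / r := by
    rw [le_div_iff₀ hr]
    have : (-Real.log C / r + Real.log n / l) * r = -Real.log C + r / l * Real.log n := by
      field_simp
    linarith
  rw [EReal.coe_le_coe_iff, EReal.coe_le_coe_iff]
  exact ⟨div_le_div_of_nonneg_left hlogn (hpos.trans_le h6) h5,
    div_le_div_of_nonneg_left hlogn hpos h6⟩

theorem le_lowerQuantizationDim (hr : 0 < r) (hb : 0 < b) (hC : 0 < C)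
    (hh : 0 < h) (hl : 0 < l)
    (hlow : ∀ n : ℕ, 1 ≤ n → ENNReal.ofReal (b * (n : ℝ) ^ (-(r / h))) ≤ quantizationError μ r n)
    (hup : ∀ n : ℕ, 1 ≤ n → quantizationError μ r n ≤ ENNReal.ofReal (C * (n : ℝ) ^ (-(r / l)))) :
    (h : EReal) ≤ lowerQuantizationDim μ r := by
  have ht := (continuous_coe_real_ereal.tendsto h).comp
    (tendsto_log_div_add_log_div (-Real.log b / r) hh)
  exact ht.liminf_eq.symm.le.trans (liminf_le_liminf
    ((eventually_quantizationRatio_mem hr hb hC hh hl hlow hup).mono fun n hn => hn.1))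

theorem upperQuantizationDim_le (hr : 0 < r) (hb : 0 < b) (hC : 0 < C)
    (hh : 0 < h) (hl : 0 < l)
    (hlow : ∀ n : ℕ, 1 ≤ n → ENNReal.ofReal (b * (n : ℝ) ^ (-(r / h))) ≤ quantizationError μ r n)
    (hup : ∀ n : ℕ, 1 ≤ n → quantizationError μ r n ≤ ENNReal.ofReal (C * (n : ℝ) ^ (-(r / l)))) :
    upperQuantizationDim μ r ≤ (l : EReal) := by
  have ht := (continuous_coe_real_ereal.tendsto l).comp
    (tendsto_log_div_add_log_div (-Real.log C / r) hl)
  exact (limsup_le_limsup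
    ((eventually_quantizationRatio_mem hr hb hC hh hl hlow hup).mono fun n hn => hn.2)).trans
    ht.limsup_eq.le

end

/-! ### Bounds for the quantization dimensions -/

theorem WeightedIFS.existsUnique_dim {Y : Type*} [MetricSpace Y] {N : ℕ} (hN : 2 ≤ N)
    (W : WeightedIFS Y N) {t : Fin N → ℝ} (ht0 : ∀ i, 0 < t i) (ht1 : ∀ i, t i < 1) {r : ℝ}
    (hr : 0 < r) : ∃! k : ℝ, 0 < k ∧ ∑ i, (W.weight i * t i ^ r) ^ (k / (r + k)) = 1 := by
  have : NeZero N := ⟨by omega⟩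
  have hlt : ∀ i, W.weight i * t i ^ r < W.weight i := fun i =>
    mul_lt_of_lt_one_right (W.weight_pos i) (Real.rpow_lt_one (ht0 i).le (ht1 i) hr)
  have hw : ∀ i, W.weight i ≤ 1 := fun i => W.weight_sum ▸
    Finset.single_le_sum (fun j _ => (W.weight_pos j).le) (Finset.mem_univ i)
  refine _root_.existsUnique_dim
    (fun i => mul_pos (W.weight_pos i) (Real.rpow_pos_of_pos (ht0 i) r))
    (fun i => (hlt i).trans_le (hw i)) (by rw [Fintype.card_fin]; omega) ?_ hr
  exact (Finset.sum_lt_sum_of_nonempty Finset.univ_nonempty fun i _ => hlt i).trans_eq W.weight_sum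

theorem mainTheorem1 (d N : ℕ) (hN : 2 ≤ N)
    (W : WeightedIFS (EuclideanSpace ℝ (Fin d)) N)
    (s c : Fin N → ℝ) (hs : ∀ i, 0 < s i) (hsc : ∀ i, s i ≤ c i) (hc : ∀ i, c i < 1)
    (hbilip : ∀ i x y, s i * ‖x - y‖ ≤ ‖W.map i x - W.map i y‖ ∧
      ‖W.map i x - W.map i y‖ ≤ c i * ‖x - y‖)
    (E : Set (EuclideanSpace ℝ (Fin d))) (hE : W.IsAttractor E)
    (hSOSC : W.StrongOpenSetCondition E)
    (μ : Measure (EuclideanSpace ℝ (Fin d))) (hμ : W.IsInvariantMeasure E μ)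
    (r : ℝ) (hr : 0 < r) :
    (∃! k : ℝ, 0 < k ∧ ∑ i, (W.weight i * s i ^ r) ^ (k / (r + k)) = 1) ∧
    (∃! l : ℝ, 0 < l ∧ ∑ i, (W.weight i * c i ^ r) ^ (l / (r + l)) = 1) ∧
    ∀ k l : ℝ,
      (0 < k ∧ ∑ i, (W.weight i * s i ^ r) ^ (k / (r + k)) = 1) →
      (0 < l ∧ ∑ i, (W.weight i * c i ^ r) ^ (l / (r + l)) = 1) →
      ((k : EReal) ≤ lowerQuantizationDim μ r ∧
        lowerQuantizationDim μ r ≤ upperQuantizationDim μ r ∧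
        upperQuantizationDim μ r ≤ (l : EReal)) ∧
      -- the self-similar case: the quantization dimension exists and is given by the formula
      (s = c → k = l ∧ Tendsto (fun n : ℕ => quantizationRatio μ r n) atTop (𝓝 (k : EReal))) := by
  have hc0 : ∀ i, 0 < c i := fun i => (hs i).trans_le (hsc i)
  have hs1 : ∀ i, s i < 1 := fun i => (hsc i).trans_lt (hc i)
  have hlo : ∀ i x y, s i * dist x y ≤ dist (W.map i x) (W.map i y) := fun i x y => by
    simpa only [dist_eq_norm] using (hbilip i x y).1
  have hhi : ∀ i x y, dist (W.map i x) (W.map i y) ≤ c i * dist x y := fun i x y => by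
    simpa only [dist_eq_norm] using (hbilip i x y).2
  refine ⟨W.existsUnique_dim hN hs hs1 hr, W.existsUnique_dim hN hc0 hc hr, ?_⟩
  rintro k l ⟨hk, hksum⟩ ⟨hl, hlsum⟩
  obtain ⟨C, hC, hup⟩ := quantizationError_le hN hE hμ hc0 hc hhi hr hl hlsum
  have hlow := fun h (hh : 0 < h) (hhk : h < k) =>
    le_quantizationError hN hE hSOSC hμ hs hs1 hc hlo hhi hr hh hhk hksum
  have h1 : (k : EReal) ≤ lowerQuantizationDim μ r := by
    have hev : ∀ᶠ h : ℝ in 𝓝[<] k, (h : EReal) ≤ lowerQuantizationDim μ r := by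
      filter_upwards [Ioo_mem_nhdsLT hk] with h hh
      obtain ⟨b, hb, hlow⟩ := hlow h hh.1 hh.2
      exact le_lowerQuantizationDim hr hb hC hh.1 hl hlow hup
    exact le_of_tendsto ((continuous_coe_real_ereal.tendsto k).mono_left nhdsWithin_le_nhds) hev
  have h2 : upperQuantizationDim μ r ≤ (l : EReal) := by
    obtain ⟨b, hb, hlow⟩ := hlow (k / 2) (half_pos hk) (half_lt_self hk)
    exact upperQuantizationDim_le hr hb hC (half_pos hk) hl hlow hup
  refine ⟨⟨h1, liminf_le_limsup, h2⟩, ?_⟩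
  rintro rfl
  have hkl : k = l := (W.existsUnique_dim hN hs hs1 hr).unique ⟨hk, hksum⟩ ⟨hl, hlsum⟩
  subst hkl
  exact ⟨rfl, tendsto_of_le_liminf_of_limsup_le h1 h2⟩
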